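/- Let $p$ be a prime, $r\ge 1$ and $n\ge 0$ integers, and $R=\mathbb{Z}_{p^r}=\mathbb{Z}/p^r\mathbb{Z}$. Let $R((D))$ be the ring of (semi-infinite) Laurent series over $R$, let $\mathcal{A}=\{0,1,\dots,p-1\}\subset R$, and let $\mathcal{A}[D]$ and $\mathcal{A}((D))$ be the sets of polynomials and of Laurent series all of whose coefficients lie in $\mathcal{A}$. A convolutional code of length $n$ over $R$ is an $R((D))$-submodule of $R((D))^n$ of the form $\mathcal{C}=\{u(D)G(D): u(D)\in R((D))^m\}$ for some $m\ge 0$ and some polynomial matrix $G(D)\in R[D]^{m\times n}$ (not necessarily of full row rank). Polynomial vectors $v_1(D),\dots,v_k(D)\in R[D]^n$ are $p$-linearly independent if $\sum_j a_j(D)v_j(D)=0$ with all $a_j(D)\in\mathcal{A}[D]$ forces all $a_j(D)=0$; constant vectors in $R^n$ are $p$-linearly independent if the same holds with coefficients $a_j\in\mathcal{A}$. The sequence $(v_1(D),\dots,v_k(D))$ is a $p$-generator sequence if for each $i$ there are $a_j(D)\in\mathcal{A}[D]$ with $p\,v_i(D)=\sum_{j>i}a_j(D)v_j(D)$ (in particular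 $p\,v_k(D)=0$). The weight $\mathrm{wt}[u(D)]\in\mathbb{N}\cup\{\infty\}$ of a vector of Laurent series is the total number of nonzero coefficients of its components. **Theorem.** Every convolutional code $\mathcal{C}$ of length $n$ over $\mathbb{Z}_{p^r}$ has a minimal $p$-encoder, that is, there are $k\ge 0$ and a matrix $G(D)\in\mathbb{Z}_{p^r}[D]^{k\times n}$ (with $k=0$, the empty matrix, when $\mathcal{C}=0$) such that: 1. ($p$-encoder) the rows of $G(D)$, in order, form a $p$-linearly independent $p$-generator sequence, and $\mathcal{C}=\{u(D)G(D): u(D)\in\mathcal{A}((D))^k\}$; 2. (delay-free) the rows of the constant matrix $G(0)$ are $p$-linearly independent; 3. (noncatastrophic) for all $u(D)\in\mathcal{A}((D))^k$: $\mathrm{wt}[u(D)G(D)]<\infty$ if and only if $\mathrm{wt}[u(D)]<\infty$; 4. (reduced) the rows of the leading row coefficient matrix $G^{lrc}$ are $p$-linearly independent, where the $j$-th row of $G^{lrc}$ is the vector of coefficients of $D^{d_j}$ in the $j$-th row of $G(D)$, and $d_j$ is the largest degree of the entries of that row. -/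

import Mathlib

open scoped Polynomial Matrix

noncomputable section

namespace PConv

/-- The set of `p`-adic digits `{0, …, p - 1}`, as a subset of `ℤ / p ^ r`. -/
def digits (p r : ℕ) : Set (ZMod (p ^ r)) :=
  {a | ∃ m : ℕ, m < p ∧ a = (m : ZMod (p ^ r))}

/-- Polynomials over `ℤ / p ^ r` all of whose coefficients are digits. -/
def digitPoly (p r : ℕ) : Set (ZMod (p ^ r))[X] :=
  {f | ∀ i, f.coeff i ∈ digits p r}

/-- Laurent series over `ℤ / p ^ r` all of whose coefficients are digits. -/
def digitLaurent (p r : ℕ) : Set (LaurentSeries (ZMod (p ^ r))) :=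
  {f | ∀ i, f.coeff i ∈ digits p r}

section Digits

variable {S : Type*} [CommRing S]

/-- The family of vectors `v` is linearly independent with respect to coefficients in `A`: the
only linear combination with coefficients in `A` that vanishes is the trivial one. With
`A = digits p r` or `A = digitPoly p r` this is `p`-linear independence of constant, respectively
polynomial, vectors. -/
def DigitIndependent (A : Set S) {k n : ℕ} (v : Fin k → Fin n → S) : Prop :=
  ∀ a : Fin k → S, (∀ j, a j ∈ A) → ∑ j, a j • v j = 0 → ∀ j, a j = 0

/-- `p` times each vector is a linear combination, with coefficients in `A`, of the vectors that
come strictly after it; for the last vector the combination is empty, so `p` times it is zero.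
With `A = digitPoly p r` these are the `p`-generator sequences. -/
def GeneratorSequence (p : ℕ) (A : Set S) {k n : ℕ} (v : Fin k → Fin n → S) : Prop :=
  ∀ i, ∃ a : Fin k → S, (∀ j, a j ∈ A) ∧ p • v i = ∑ j ∈ Finset.Ioi i, a j • v j

end Digits

section Polynomials

variable {R : Type*} [CommRing R]

/-- The inclusion of polynomials in Laurent series. -/
def polyToLaurent (R : Type*) [CommRing R] : R[X] →+* LaurentSeries R :=
  (HahnSeries.ofPowerSeries ℤ R).comp Polynomial.coeToPowerSeries.ringHom

/-- The output `u(D) G(D)` produced by the polynomial matrix `G` from the input `u`. -/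
def encode {k n : ℕ} (G : Matrix (Fin k) (Fin n) R[X]) (u : Fin k → LaurentSeries R) :
    Fin n → LaurentSeries R :=
  u ᵥ* G.map (polyToLaurent R)

/-- The Hamming weight of a vector of Laurent series: the total number of nonzero coefficients of
its components, possibly infinite. -/
def weight {m : ℕ} (u : Fin m → LaurentSeries R) : ℕ∞ :=
  ∑ i, {e : ℤ | (u i).coeff e ≠ 0}.encard

/-- The degree of a polynomial vector: the largest degree of its components. -/
def rowDegree {n : ℕ} (v : Fin n → R[X]) : ℕ :=
  Finset.univ.sup fun i => (v i).natDegree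

/-- The leading row coefficient matrix. -/
def leadingRowCoeff {k n : ℕ} (G : Matrix (Fin k) (Fin n) R[X]) : Matrix (Fin k) (Fin n) R :=
  fun j i => (G j i).coeff (rowDegree (G j))

/-- The matrix `G(0)`. -/
def valueAtZero {k n : ℕ} (G : Matrix (Fin k) (Fin n) R[X]) : Matrix (Fin k) (Fin n) R :=
  fun j i => (G j i).eval 0

/-- Convolutional codes of length `n` over `R`: submodules of `R((D))ⁿ` that are the image of a
polynomial generator matrix, which need not have full row rank. -/
def IsConvolutionalCode {n : ℕ} (C : Submodule (LaurentSeries R) (Fin n → LaurentSeries R)) :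
    Prop :=
  ∃ (k : ℕ) (G : Matrix (Fin k) (Fin n) R[X]), ∀ v, v ∈ C ↔ ∃ u, v = encode G u

end Polynomials

/-- `G` is a `p`-encoder of `C`. -/
structure IsPEncoder (p r : ℕ) {k n : ℕ} (G : Matrix (Fin k) (Fin n) (ZMod (p ^ r))[X])
    (C : Submodule (LaurentSeries (ZMod (p ^ r))) (Fin n → LaurentSeries (ZMod (p ^ r)))) :
    Prop where
  generatorSequence : GeneratorSequence p (digitPoly p r) G
  independent : DigitIndependent (digitPoly p r) G
  mem_iff : ∀ v, v ∈ C ↔ ∃ u, (∀ j, u j ∈ digitLaurent p r) ∧ v = encode G u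

/-- `G` is noncatastrophic for inputs whose coefficients are digits. -/
def IsNoncatastrophic (p r : ℕ) {k n : ℕ} (G : Matrix (Fin k) (Fin n) (ZMod (p ^ r))[X]) : Prop :=
  ∀ u : Fin k → LaurentSeries (ZMod (p ^ r)), (∀ j, u j ∈ digitLaurent p r) →
    (weight (encode G u) < ⊤ ↔ weight u < ⊤)

/-- `G` is delay-free: the rows of `G(0)` are `p`-linearly independent. -/
def IsDelayFree (p r : ℕ) {k n : ℕ} (G : Matrix (Fin k) (Fin n) (ZMod (p ^ r))[X]) : Prop :=
  DigitIndependent (digits p r) (valueAtZero G)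

/-- `G` is a minimal `p`-encoder of `C`. -/
structure IsMinimalPEncoder (p r : ℕ) {k n : ℕ} (G : Matrix (Fin k) (Fin n) (ZMod (p ^ r))[X])
    (C : Submodule (LaurentSeries (ZMod (p ^ r))) (Fin n → LaurentSeries (ZMod (p ^ r)))) :
    Prop where
  isPEncoder : IsPEncoder p r G C
  delayFree : IsDelayFree p r G
  noncatastrophic : IsNoncatastrophic p r G
  reduced : DigitIndependent (digits p r) (leadingRowCoeff G)

end PConv

end

/-!
Let `R = ℤ / p ^ r`, and let `M` be the module of polynomial words of the code `C` (`polyWords`).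
The theorem reduces to a statement about an arbitrary submodule `M` of `R[D]ⁿ`: it has a generator
sequence `G`, spanning `M` with digit coefficients, whose leading row coefficients are
`p`-linearly independent (`exists_reduced_generatorSequence`).

To construct `G`, let `L d` be the `R`-module of coefficients of `D ^ d` of the elements of `M` of
degree at most `d` (`leadModule`). These form an increasing chain of submodules of `Rⁿ`, which
stabilises. Refine it to a chain each of whose steps adjoins one vector `v` with `p • v` already
present, and lift each such `v` to an element of `M` of degree `d` with leading coefficient `v`.
Each new element is placed *in front* of the earlier ones. The leading coefficients are independent
because a nonzero digit is a unit of `R`. Division by leading terms, in which the digits of the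
quotients are found one degree at a time, shows that the rows found up to degree `d` span the
elements of `M` of degree at most `d`; applied to `p` times a new element it gives the generator
property. The induction is carried by `PartialBasis`, with the two kinds of steps
`PartialBasis.cons` and `PartialBasis.succ`.

For `M = polyWords C` the other properties follow formally. Comparing terms of highest degree,
`G` is `p`-linearly independent (`digitIndependent_of_reduced`), and then digit coefficients are
unique (`GeneratorSequence.digits_unique`). Since `M` is saturated with respect to `D`, uniqueness
makes `G` delay-free (`isDelayFree_of_generates`). Comparing terms of lowest order, `G` is then also
independent, with uniqueness, over Laurent series with digit coefficients. A word of finite weight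
is, up to a power of `D`, in `M`, hence the output of a polynomial input, and by uniqueness this is
the given input (`isNoncatastrophic_of_generates`).
-/

noncomputable section

namespace PConv

/-! ### Digit systems -/

/-- `A` is a system of digits for `p` in `S`: it contains zero and exactly one representative of
each residue class modulo `p`. -/
structure IsDigitSystem {S : Type*} [CommRing S] (p : ℕ) (A : Set S) : Prop where
  zero_mem : (0 : S) ∈ A
  exists_eq_add : ∀ s, ∃ a ∈ A, ∃ t, s = a + p * t
  eq_of_sub_eq : ∀ a ∈ A, ∀ b ∈ A, ∀ t, a - b = p * t → a = b

section DigitSystem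

variable {S : Type*} [CommRing S] {p : ℕ} {A : Set S} {n : ℕ}

lemma GeneratorSequence.tail {k : ℕ} {v : Fin (k + 1) → Fin n → S}
    (h : GeneratorSequence p A v) : GeneratorSequence p A (Fin.tail v) := by
  intro i
  obtain ⟨a, ha, he⟩ := h i.succ
  refine ⟨Fin.tail a, fun j => ha _, ?_⟩
  rw [Fin.sum_Ioi_succ] at he
  exact he

lemma GeneratorSequence.cons {k : ℕ} {v : Fin k → Fin n → S} (h : GeneratorSequence p A v)
    (h0 : (0 : S) ∈ A) {w : Fin n → S} {a : Fin k → S} (ha : ∀ j, a j ∈ A)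
    (hw : p • w = ∑ j, a j • v j) :
    GeneratorSequence p A (Fin.cons w v : Fin (k + 1) → Fin n → S) := by
  have cons_mem : ∀ b : Fin k → S, (∀ j, b j ∈ A) → ∀ j, (Fin.cons 0 b : Fin (k + 1) → S) j ∈ A :=
    fun b hb j => Fin.cases (by simpa using h0) (fun j => by simpa using hb j) j
  intro i
  refine Fin.cases ?_ (fun i => ?_) i
  · refine ⟨Fin.cons 0 a, cons_mem a ha, ?_⟩
    simpa [Fin.sum_Ioi_zero] using hw
  · obtain ⟨b, hb, he⟩ := h i
    refine ⟨Fin.cons 0 b, cons_mem b hb, ?_⟩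
    simpa [Fin.sum_Ioi_succ] using he

lemma DigitIndependent.tail {k : ℕ} {v : Fin (k + 1) → Fin n → S} (h0 : (0 : S) ∈ A)
    (h : DigitIndependent A v) : DigitIndependent A (Fin.tail v) := by
  intro a ha hs j
  have := h (Fin.cons 0 a)
    (fun j => Fin.cases (by simpa using h0) (fun j => by simpa using ha j) j)
    (by simpa [Fin.sum_univ_succ, Fin.tail] using hs) j.succ
  simpa using this

/-- Along a generator sequence every linear combination can be rewritten with digit coefficients:
the part of a coefficient that is divisible by `p` is carried over to later vectors. -/
lemma GeneratorSequence.exists_digits (hA : IsDigitSystem p A) {k : ℕ} {v : Fin k → Fin n → S}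
    (h : GeneratorSequence p Set.univ v) (c : Fin k → S) :
    ∃ u : Fin k → S, (∀ j, u j ∈ A) ∧ ∑ j, c j • v j = ∑ j, u j • v j := by
  induction k with
  | zero => exact ⟨c, fun j => j.elim0, rfl⟩
  | succ k ih =>
    obtain ⟨a, ha, t, hc⟩ := hA.exists_eq_add (c 0)
    obtain ⟨b, -, hb⟩ := h 0
    obtain ⟨u, hu, he⟩ := ih h.tail fun j => c j.succ + t * b j.succ
    refine ⟨Fin.cons a u, Fin.forall_fin_succ.2 ⟨ha, hu⟩, ?_⟩
    rw [Fin.sum_Ioi_zero] at hb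
    have hb' : c 0 • v 0 = a • v 0 + ∑ j : Fin k, (t * b j.succ) • v j.succ := by
      rw [hc, add_smul, mul_comm, mul_smul, Nat.cast_smul_eq_nsmul, hb, Finset.smul_sum]
      simp only [mul_smul]
    simp only [Fin.tail, add_smul, Finset.sum_add_distrib] at he
    rw [Fin.sum_univ_succ, Fin.sum_univ_succ, hb', Fin.cons_zero]
    simp only [Fin.cons_succ]
    rw [← he]
    abel

lemma GeneratorSequence.mono {B : Set S} (hAB : A ⊆ B) {k : ℕ} {v : Fin k → Fin n → S}
    (h : GeneratorSequence p A v) : GeneratorSequence p B v := fun i =>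
  let ⟨a, ha, he⟩ := h i
  ⟨a, fun j => hAB (ha j), he⟩

/-- Digit coefficients with respect to an independent generator sequence are unique. Independence
alone concerns combinations that vanish; the difference of two digits is not a digit, and the
generator property is what turns a difference of combinations into a combination with digit
coefficients. -/
lemma GeneratorSequence.digits_unique (hA : IsDigitSystem p A) {k : ℕ} {v : Fin k → Fin n → S}
    (h : GeneratorSequence p Set.univ v) (hi : DigitIndependent A v) {u w : Fin k → S}
    (hu : ∀ j, u j ∈ A) (hw : ∀ j, w j ∈ A) (he : ∑ j, u j • v j = ∑ j, w j • v j) : u = w := by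
  induction k with
  | zero => exact funext fun j => j.elim0
  | succ k ih =>
    have h0 : u 0 = w 0 := by
      -- Digitising the difference keeps the digit `a` of the first coefficient, which is zero only
      -- if the two first coefficients are congruent modulo `p`.
      obtain ⟨a, ha, t, hc⟩ := hA.exists_eq_add (u 0 - w 0)
      obtain ⟨b, -, hb⟩ := h 0
      rw [Fin.sum_Ioi_zero] at hb
      obtain ⟨x, hx, hxe⟩ := h.tail.exists_digits hA
        fun j => (u j.succ - w j.succ) + t * b j.succ
      have key : ∑ j, (Fin.cons a x : Fin (k + 1) → S) j • v j = 0 := by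
        have hb' : (u 0 - w 0) • v 0 = a • v 0 + ∑ j : Fin k, (t * b j.succ) • v j.succ := by
          rw [hc, add_smul, mul_comm, mul_smul, Nat.cast_smul_eq_nsmul, hb, Finset.smul_sum]
          simp only [mul_smul]
        rw [← sub_eq_zero, ← Finset.sum_sub_distrib] at he
        simp only [← sub_smul] at he
        simp only [Fin.tail, add_smul, Finset.sum_add_distrib] at hxe
        rw [Fin.sum_univ_succ, hb'] at he
        rw [Fin.sum_univ_succ, Fin.cons_zero]
        simp only [Fin.cons_succ]
        rw [← hxe, ← he]
        abel
      have ha0 : a = 0 := by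
        simpa using hi (Fin.cons a x)
          (fun j => Fin.cases (by simpa using ha) (fun j => by simpa using hx j) j) key 0
      exact hA.eq_of_sub_eq _ (hu 0) _ (hw 0) t (by rw [hc, ha0, zero_add])
    have ht : Fin.tail u = Fin.tail w := by
      refine ih h.tail (hi.tail hA.zero_mem) (fun j => hu _) (fun j => hw _) ?_
      rw [Fin.sum_univ_succ, Fin.sum_univ_succ, h0] at he
      exact add_left_cancel he
    exact funext fun j => Fin.cases h0 (fun j => congrFun ht j) j

end DigitSystem

/-! ### Digits modulo a prime power -/

section Residue

variable {p r : ℕ}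

/-- The digit of a residue modulo `p ^ r`. -/
def digitPart (p r : ℕ) (s : ZMod (p ^ r)) : ZMod (p ^ r) := ((s.val % p : ℕ) : ZMod (p ^ r))

/-- The quotient that remains of a residue modulo `p ^ r` once its digit is removed. -/
def carryPart (p r : ℕ) (s : ZMod (p ^ r)) : ZMod (p ^ r) := ((s.val / p : ℕ) : ZMod (p ^ r))

@[simp] lemma digitPart_zero : digitPart p r 0 = 0 := by simp [digitPart]

@[simp] lemma carryPart_zero : carryPart p r 0 = 0 := by simp [carryPart]

lemma digitPart_mem (hp : p.Prime) (s : ZMod (p ^ r)) : digitPart p r s ∈ digits p r :=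
  ⟨s.val % p, Nat.mod_lt _ hp.pos, rfl⟩

lemma digitPart_add_carryPart (hp : p.Prime) (s : ZMod (p ^ r)) :
    s = digitPart p r s + p * carryPart p r s := by
  have : NeZero (p ^ r) := ⟨pow_ne_zero _ hp.ne_zero⟩
  rw [digitPart, carryPart, ← Nat.cast_mul, ← Nat.cast_add, Nat.mod_add_div, ZMod.natCast_zmod_val]

lemma zero_mem_digits (hp : p.Prime) : (0 : ZMod (p ^ r)) ∈ digits p r :=
  ⟨0, hp.pos, by simp⟩

lemma digits_eq_of_sub_eq (hr : 1 ≤ r) {a b t : ZMod (p ^ r)} (ha : a ∈ digits p r)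
    (hb : b ∈ digits p r) (h : a - b = p * t) : a = b := by
  obtain ⟨m, hm, rfl⟩ := ha
  obtain ⟨l, hl, rfl⟩ := hb
  have := congrArg (ZMod.castHom (dvd_pow_self p (by omega : r ≠ 0)) (ZMod p)) h
  simp only [map_sub, map_natCast, map_mul, CharP.cast_eq_zero, zero_mul, sub_eq_zero] at this
  rw [ZMod.natCast_eq_natCast_iff', Nat.mod_eq_of_lt hm, Nat.mod_eq_of_lt hl] at this
  rw [this]

lemma isUnit_of_mem_digits (hp : p.Prime) {a : ZMod (p ^ r)} (ha : a ∈ digits p r)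
    (h0 : a ≠ 0) : IsUnit a := by
  obtain ⟨m, hm, rfl⟩ := ha
  have hm0 : m ≠ 0 := by rintro rfl; simp at h0
  rw [ZMod.isUnit_iff_coprime]
  exact Nat.Coprime.pow_right _ (Nat.coprime_of_lt_prime hm0 hm hp).symm

lemma isDigitSystem_digitPoly (hp : p.Prime) (hr : 1 ≤ r) :
    IsDigitSystem p (digitPoly p r) where
  zero_mem i := by simpa using zero_mem_digits hp
  exists_eq_add f := by
    refine ⟨∑ i ∈ f.support, Polynomial.monomial i (digitPart p r (f.coeff i)), fun i => ?_,
      ∑ i ∈ f.support, Polynomial.monomial i (carryPart p r (f.coeff i)), ?_⟩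
    · rw [Polynomial.finsetSum_coeff]
      simp only [Polynomial.coeff_monomial, Finset.sum_ite_eq']
      split_ifs
      · exact digitPart_mem hp _
      · exact zero_mem_digits hp
    · conv_lhs => rw [f.as_sum_support]
      rw [Finset.mul_sum, ← Finset.sum_add_distrib]
      refine Finset.sum_congr rfl fun i _ => ?_
      rw [← Polynomial.C_eq_natCast, Polynomial.C_mul_monomial, ← map_add,
        ← digitPart_add_carryPart hp]
  eq_of_sub_eq f hf g hg t h := by
    ext i
    refine digits_eq_of_sub_eq hr (t := t.coeff i) (hf i) (hg i) ?_
    rw [← Polynomial.coeff_sub, h, ← Polynomial.C_eq_natCast, Polynomial.coeff_C_mul]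

lemma natCast_mul_coeff (m : ℕ) (f : LaurentSeries (ZMod (p ^ r))) (i : ℤ) :
    ((m : LaurentSeries (ZMod (p ^ r))) * f).coeff i = m * f.coeff i := by
  rw [← nsmul_eq_mul, ← nsmul_eq_mul]
  rw [HahnSeries.coeff_nsmul, Pi.smul_apply]

lemma isDigitSystem_digitLaurent (hp : p.Prime) (hr : 1 ≤ r) :
    IsDigitSystem p (digitLaurent p r) where
  zero_mem i := by simpa using zero_mem_digits hp
  exists_eq_add f := by
    refine ⟨f.map (⟨digitPart p r, digitPart_zero⟩ : ZeroHom _ _), fun i => ?_,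
      f.map (⟨carryPart p r, carryPart_zero⟩ : ZeroHom _ _), ?_⟩
    · exact digitPart_mem hp _
    · ext i
      rw [HahnSeries.coeff_add, natCast_mul_coeff]
      exact digitPart_add_carryPart hp _
  eq_of_sub_eq f hf g hg t h := by
    ext i
    refine digits_eq_of_sub_eq hr (t := t.coeff i) (hf i) (hg i) ?_
    rw [← HahnSeries.coeff_sub, h, natCast_mul_coeff]

end Residue

/-! ### Reduced generators of a polynomial module -/

section Coefficients

variable {R : Type*} [CommRing R] {n : ℕ}

/-- The vector of coefficients of `D ^ d` of a polynomial vector. -/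
def coeffVec (d : ℕ) : (Fin n → R[X]) →ₗ[R] (Fin n → R) :=
  (Polynomial.lcoeff R d).compLeft (Fin n)

@[simp] lemma coeffVec_apply (d : ℕ) (w : Fin n → R[X]) (i : Fin n) :
    coeffVec d w i = (w i).coeff d := rfl

/-- All components of `w` have degree at most `d`. -/
def DegreeLE (d : ℕ) (w : Fin n → R[X]) : Prop := ∀ e, d < e → coeffVec e w = 0

lemma eq_zero_of_coeffVec {w : Fin n → R[X]} (h : ∀ e, coeffVec e w = 0) : w = 0 := by
  ext i e
  exact congrFun (h e) i

lemma degreeLE_rowDegree (w : Fin n → R[X]) : DegreeLE (rowDegree w) w := by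
  intro e he
  ext i
  exact Polynomial.coeff_eq_zero_of_natDegree_lt
    (lt_of_le_of_lt (Finset.le_sup (f := fun i => (w i).natDegree) (Finset.mem_univ i)) he)

lemma DegreeLE.rowDegree_le {d : ℕ} {w : Fin n → R[X]} (h : DegreeLE d w) : rowDegree w ≤ d :=
  Finset.sup_le fun i _ => Polynomial.natDegree_le_iff_coeff_eq_zero.2 fun e he =>
    congrFun (h e he) i

lemma DegreeLE.rowDegree_eq {d : ℕ} {w : Fin n → R[X]} (h : DegreeLE d w)
    (h0 : coeffVec d w ≠ 0) : rowDegree w = d := by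
  refine le_antisymm h.rowDegree_le (not_lt.1 fun hlt => h0 (degreeLE_rowDegree w d hlt))

lemma DegreeLE.sub {d : ℕ} {v w : Fin n → R[X]} (hv : DegreeLE d v) (hw : DegreeLE d w) :
    DegreeLE d (v - w) := fun e he => by rw [map_sub, hv e he, hw e he, sub_zero]

lemma DegreeLE.add {d : ℕ} {v w : Fin n → R[X]} (hv : DegreeLE d v) (hw : DegreeLE d w) :
    DegreeLE d (v + w) := fun e he => by rw [map_add, hv e he, hw e he, add_zero]

lemma DegreeLE.smul {d : ℕ} {v : Fin n → R[X]} (hv : DegreeLE d v) (c : R) :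
    DegreeLE d (c • v) := fun e he => by rw [map_smul, hv e he, smul_zero]

/-- The leading coefficient vector of a polynomial vector, that is, a row of the leading row
coefficient matrix. -/
def leadVec (w : Fin n → R[X]) : Fin n → R := coeffVec (rowDegree w) w

lemma DegreeLE.leadVec_eq {d : ℕ} {w : Fin n → R[X]} (h : DegreeLE d w)
    (h0 : coeffVec d w ≠ 0) : leadVec w = coeffVec d w := by
  rw [leadVec, h.rowDegree_eq h0]

lemma coeffVec_X_pow_smul (m e : ℕ) (w : Fin n → R[X]) :
    coeffVec e ((Polynomial.X ^ m : R[X]) • w) = if m ≤ e then coeffVec (e - m) w else 0 := by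
  ext i
  simp only [coeffVec_apply, Pi.smul_apply, smul_eq_mul, Polynomial.coeff_X_pow_mul']
  split_ifs <;> rfl

lemma coeffVec_C_mul_X_pow_smul (b : R) (m e : ℕ) (w : Fin n → R[X]) :
    coeffVec e ((Polynomial.C b * Polynomial.X ^ m : R[X]) • w) =
      if m ≤ e then b • coeffVec (e - m) w else 0 := by
  ext i
  simp only [coeffVec_apply, Pi.smul_apply, smul_eq_mul, mul_assoc, Polynomial.coeff_C_mul,
    Polynomial.coeff_X_pow_mul']
  split_ifs <;> simp

/-- The top coefficient of a product of a polynomial and a vector, at a degree bound which need not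
be attained. -/
lemma coeffVec_smul_of_bounds {d e : ℕ} {a : R[X]} {w : Fin n → R[X]}
    (ha : a.natDegree ≤ e) (hw : DegreeLE d w) :
    coeffVec (e + d) (a • w) = a.coeff e • coeffVec d w := by
  ext i
  exact Polynomial.coeff_mul_add_eq_of_natDegree_le ha
    (Polynomial.natDegree_le_iff_coeff_eq_zero.2 fun e he => congrFun (hw e he) i)

/-- The vectors of coefficients of `D ^ d` of the elements of `M` of degree at most `d`. -/
def leadModule (M : Submodule R[X] (Fin n → R[X])) (d : ℕ) : Submodule R (Fin n → R) where
  carrier := {v | ∃ w ∈ M, DegreeLE d w ∧ coeffVec d w = v}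
  zero_mem' := ⟨0, M.zero_mem, fun e _ => map_zero _, map_zero _⟩
  add_mem' := by
    rintro _ _ ⟨v, hv, hvd, rfl⟩ ⟨w, hw, hwd, rfl⟩
    exact ⟨v + w, M.add_mem hv hw, hvd.add hwd, map_add _ _ _⟩
  smul_mem' := by
    rintro c _ ⟨v, hv, hvd, rfl⟩
    refine ⟨c • v, ?_, hvd.smul c, map_smul _ _ _⟩
    rw [← algebraMap_smul R[X] c v]
    exact M.smul_mem _ hv

lemma leadModule_mono (M : Submodule R[X] (Fin n → R[X])) : Monotone (leadModule M) := by
  refine monotone_nat_of_le_succ fun d => ?_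
  rintro _ ⟨w, hw, hwd, rfl⟩
  refine ⟨(Polynomial.X ^ 1 : R[X]) • w, M.smul_mem _ hw, fun e he => ?_, ?_⟩
  · rw [coeffVec_X_pow_smul, if_pos (by omega), hwd _ (by omega)]
  · rw [coeffVec_X_pow_smul, if_pos (by omega), Nat.add_sub_cancel]

end Coefficients

section Reduced

variable {p r n : ℕ}

/-- Independence of the leading row coefficients passes to polynomial coefficients: in a nontrivial
combination the terms of the largest total degree `deg a j + d j` cannot cancel. -/
lemma digitIndependent_of_reduced {k : ℕ} {G : Fin k → Fin n → (ZMod (p ^ r))[X]}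
    (hp : p.Prime) (h : DigitIndependent (digits p r) fun j => leadVec (G j)) :
    DigitIndependent (digitPoly p r) G := by
  intro a ha hs
  by_contra hne
  push Not at hne
  let s : Finset (Fin k) := Finset.univ.filter fun j => a j ≠ 0
  obtain ⟨j₀, hj₀⟩ := hne
  obtain ⟨m, hm, hmax⟩ := s.exists_max_image (fun j => (a j).natDegree + rowDegree (G j))
    ⟨j₀, by simpa [s] using hj₀⟩
  set N := (a m).natDegree + rowDegree (G m) with hN
  let b : Fin k → ZMod (p ^ r) := fun j =>
    if rowDegree (G j) ≤ N then (a j).coeff (N - rowDegree (G j)) else 0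
  have hb : ∀ j, b j ∈ digits p r := fun j => by
    simp only [b]
    split_ifs
    · exact ha j _
    · exact zero_mem_digits hp
  have hterm : ∀ j, coeffVec N (a j • G j) = b j • leadVec (G j) := fun j => by
    by_cases h0 : a j = 0
    · simp [b, h0]
    · have hle : (a j).natDegree + rowDegree (G j) ≤ N := hmax j (by simpa [s] using h0)
      have hr : rowDegree (G j) ≤ N := by omega
      simp only [b, if_pos hr, leadVec]
      rw [← coeffVec_smul_of_bounds (by omega) (degreeLE_rowDegree (G j)), Nat.sub_add_cancel hr]
  have hsum : ∑ j, b j • leadVec (G j) = 0 := by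
    have := congrArg (coeffVec N) hs
    rw [map_sum, map_zero] at this
    rw [← this]
    exact Finset.sum_congr rfl fun j _ => (hterm j).symm
  have hbm := h b hb hsum m
  simp only [b, if_pos (show rowDegree (G m) ≤ N by omega)] at hbm
  rw [hN, Nat.add_sub_cancel] at hbm
  exact (Finset.mem_filter.1 hm).2 (Polynomial.leadingCoeff_eq_zero.1 hbm)

/-- A partially built reduced generator sequence `G` of `M`. It accounts for the elements of `M` of
degree at most `d` whose coefficient of `D ^ d` lies in `P`: each of these is a combination
`∑ a j • G j` with digit coefficients in which no term `D ^ e • G j` of degree above `d` occurs. -/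
structure PartialBasis (M : Submodule (ZMod (p ^ r))[X] (Fin n → (ZMod (p ^ r))[X])) (d : ℕ)
    (P : Submodule (ZMod (p ^ r)) (Fin n → ZMod (p ^ r))) {k : ℕ}
    (G : Fin k → Fin n → (ZMod (p ^ r))[X]) : Prop where
  mem : ∀ j, G j ∈ M
  rowDegree_le : ∀ j, rowDegree (G j) ≤ d
  lead_mem : ∀ j, leadVec (G j) ∈ P
  generator : GeneratorSequence p (digitPoly p r) G
  reduced : DigitIndependent (digits p r) fun j => leadVec (G j)
  exists_lead : ∀ v ∈ P, ∃ b : Fin k → ZMod (p ^ r), (∀ j, b j ∈ digits p r) ∧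
    v = ∑ j, b j • leadVec (G j)
  exists_digits : ∀ w ∈ M, DegreeLE d w → coeffVec d w ∈ P → ∃ a : Fin k → (ZMod (p ^ r))[X],
    (∀ j, a j ∈ digitPoly p r) ∧ (∀ j e, d < e + rowDegree (G j) → (a j).coeff e = 0) ∧
      w = ∑ j, a j • G j

variable {M : Submodule (ZMod (p ^ r))[X] (Fin n → (ZMod (p ^ r))[X])} {d k : ℕ}
  {P : Submodule (ZMod (p ^ r)) (Fin n → ZMod (p ^ r))} {G : Fin k → Fin n → (ZMod (p ^ r))[X]}

lemma partialBasis_zero : PartialBasis M 0 ⊥ (fun j : Fin 0 => j.elim0) where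
  mem j := j.elim0
  rowDegree_le j := j.elim0
  lead_mem j := j.elim0
  generator j := j.elim0
  reduced _ _ _ j := j.elim0
  exists_lead v hv := ⟨fun j => j.elim0, fun j => j.elim0, by simpa using hv⟩
  exists_digits w _ hd h0 := by
    refine ⟨fun j => j.elim0, fun j => j.elim0, fun j => j.elim0, ?_⟩
    rw [Finset.univ_eq_empty, Finset.sum_empty]
    refine eq_zero_of_coeffVec fun e => ?_
    rcases Nat.eq_zero_or_pos e with rfl | he
    · exact (Submodule.mem_bot _).1 h0
    · exact hd e he

/-- Adding in front an element of `M` of degree `d` whose leading coefficient `v` is new but has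
`p • v` old. -/
lemma PartialBasis.cons (hp : p.Prime) (h : PartialBasis M d P G)
    {w : Fin n → (ZMod (p ^ r))[X]} (hw : w ∈ M) (hwd : DegreeLE d w) (hv : coeffVec d w ∉ P)
    (hpv : p • coeffVec d w ∈ P) :
    PartialBasis M d (P ⊔ Submodule.span _ {coeffVec d w})
      (Fin.cons w G : Fin (k + 1) → Fin n → (ZMod (p ^ r))[X]) := by
  have hv0 : coeffVec d w ≠ 0 := fun h0 => hv (h0 ▸ P.zero_mem)
  have hwr : rowDegree w = d := hwd.rowDegree_eq hv0
  have hwl : leadVec w = coeffVec d w := hwd.leadVec_eq hv0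
  -- An element of the enlarged submodule becomes old once a digit multiple of `v` is removed.
  have hdig : ∀ x ∈ P ⊔ Submodule.span _ {coeffVec d w},
      ∃ c ∈ digits p r, x - c • coeffVec d w ∈ P := by
    intro x hx
    obtain ⟨y, hy, z, hz, rfl⟩ := Submodule.mem_sup.1 hx
    obtain ⟨c, rfl⟩ := Submodule.mem_span_singleton.1 hz
    refine ⟨digitPart p r c, digitPart_mem hp c, ?_⟩
    have : y + c • coeffVec d w - digitPart p r c • coeffVec d w =
        y + carryPart p r c • p • coeffVec d w := by
      rw [add_sub_assoc, ← sub_smul, sub_eq_of_eq_add' (digitPart_add_carryPart hp c),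
        ← Nat.cast_smul_eq_nsmul (ZMod (p ^ r)), smul_smul, mul_comm (carryPart p r c)]
    rw [this]
    exact P.add_mem hy (P.smul_mem _ hpv)
  refine
    { mem := Fin.forall_fin_succ.2 ⟨hw, h.mem⟩
      rowDegree_le := Fin.forall_fin_succ.2 ⟨hwr.le, h.rowDegree_le⟩
      lead_mem := Fin.forall_fin_succ.2 ⟨?_, fun j => ?_⟩
      generator := ?_
      reduced := ?_
      exists_lead := ?_
      exists_digits := ?_ }
  · rw [Fin.cons_zero, hwl]
    exact Submodule.mem_sup_right (Submodule.mem_span_singleton_self _)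
  · exact Submodule.mem_sup_left (h.lead_mem j)
  · obtain ⟨a, ha, -, he⟩ := h.exists_digits (p • w) (M.smul_of_tower_mem p hw)
      (fun e he => by rw [map_nsmul, hwd e he, smul_zero]) (by rwa [map_nsmul])
    exact h.generator.cons (fun i => by simpa using zero_mem_digits hp) ha he
  · intro a ha hs
    rw [Fin.sum_univ_succ] at hs
    simp only [Fin.cons_zero, Fin.cons_succ, hwl] at hs
    -- A nonzero digit is a unit, so a nonzero first coefficient would put `v` into `P`.
    have h0 : a 0 = 0 := by
      by_contra h0
      refine hv ((P.smul_mem_iff_of_isUnit (isUnit_of_mem_digits hp (ha 0) h0)).1 ?_)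
      rw [eq_neg_of_add_eq_zero_left hs]
      exact P.neg_mem (P.sum_mem fun j _ => P.smul_mem _ (h.lead_mem j))
    rw [h0, zero_smul, zero_add] at hs
    exact Fin.forall_fin_succ.2 ⟨h0, h.reduced (fun j => a j.succ) (fun j => ha _) hs⟩
  · intro x hx
    obtain ⟨c, hc, hxc⟩ := hdig x hx
    obtain ⟨b, hb, he⟩ := h.exists_lead _ hxc
    refine ⟨Fin.cons c b, Fin.forall_fin_succ.2 ⟨hc, hb⟩, ?_⟩
    rw [Fin.sum_univ_succ]
    simp only [Fin.cons_zero, Fin.cons_succ, hwl]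
    rw [← he, add_sub_cancel]
  · intro x hx hxd hxP
    obtain ⟨c, hc, hxc⟩ := hdig _ hxP
    obtain ⟨a, ha, had, he⟩ := h.exists_digits (x - c • w)
      (M.sub_mem hx (M.smul_of_tower_mem c hw)) (hxd.sub (hwd.smul c))
      (by rwa [map_sub, map_smul])
    refine ⟨Fin.cons (Polynomial.C c) a, Fin.forall_fin_succ.2 ⟨fun i => ?_, ha⟩,
      Fin.forall_fin_succ.2 ⟨fun e hlt => ?_, had⟩, ?_⟩
    · simp only [Fin.cons_zero, Polynomial.coeff_C]
      split_ifs
      · exact hc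
      · exact zero_mem_digits hp
    · simp only [Fin.cons_zero, hwr] at hlt ⊢
      exact Polynomial.coeff_C_of_ne_zero (by omega)
    · rw [Fin.sum_univ_succ]
      simp only [Fin.cons_zero, Fin.cons_succ]
      rw [← he, ← Polynomial.algebraMap_eq, algebraMap_smul, add_sub_cancel]

/-- Once all leading coefficients in degree `d` are accounted for, the bound on the degree can be
raised: subtracting shifted rows from an element of degree `d + 1` lowers its degree. -/
lemma PartialBasis.succ (h : PartialBasis M d (leadModule M d) G) :
    PartialBasis M (d + 1) (leadModule M d) G where
  mem := h.mem
  rowDegree_le j := (h.rowDegree_le j).trans d.le_succ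
  lead_mem := h.lead_mem
  generator := h.generator
  reduced := h.reduced
  exists_lead := h.exists_lead
  exists_digits w hw hwd hwP := by
    obtain ⟨b, hb, hbe⟩ := h.exists_lead _ hwP
    let f : Fin k → (ZMod (p ^ r))[X] := fun j =>
      Polynomial.C (b j) * Polynomial.X ^ (d + 1 - rowDegree (G j))
    have hfM : ∑ j, f j • G j ∈ M := M.sum_mem fun j _ => M.smul_mem _ (h.mem j)
    have hsub : DegreeLE d (w - ∑ j, f j • G j) := by
      intro e he
      rw [map_sub, map_sum]
      simp only [f, coeffVec_C_mul_X_pow_smul]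
      rcases Nat.lt_or_ge (d + 1) e with hlt | hle
      · rw [hwd e hlt, zero_sub, neg_eq_zero]
        refine Finset.sum_eq_zero fun j _ => ?_
        have := h.rowDegree_le j
        rw [if_pos (by omega), degreeLE_rowDegree (G j) _ (by omega), smul_zero]
      · obtain rfl : e = d + 1 := by omega
        rw [hbe, sub_eq_zero]
        refine Finset.sum_congr rfl fun j _ => ?_
        have := h.rowDegree_le j
        rw [if_pos (by omega), leadVec]
        congr 3
        omega
    have hsM := M.sub_mem hw hfM
    obtain ⟨a, ha, had, he⟩ := h.exists_digits _ hsM hsub ⟨_, hsM, hsub, rfl⟩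
    refine ⟨fun j => f j + a j, fun j e => ?_, fun j e hlt => ?_, ?_⟩
    · -- The new term sits above all terms of `a j`, so that no two digits are added.
      have := h.rowDegree_le j
      simp only [f, Polynomial.coeff_add, Polynomial.coeff_C_mul_X_pow]
      split_ifs with hc
      · rw [had j e (by omega), add_zero]
        exact hb j
      · rw [zero_add]
        exact ha j e
    · have := h.rowDegree_le j
      simp only [f, Polynomial.coeff_add, Polynomial.coeff_C_mul_X_pow]
      rw [if_neg (by omega), had j e (by omega), add_zero]
    · simp only [add_smul, Finset.sum_add_distrib]
      rw [← he, add_sub_cancel]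

/-- A proper submodule of a module over `ℤ / p ^ r` misses some vector whose multiple by `p` it
contains. -/
lemma exists_notMem_nsmul_mem {V : Type*} [AddCommGroup V] [Module (ZMod (p ^ r)) V]
    {P Q : Submodule (ZMod (p ^ r)) V} (h : P < Q) : ∃ v ∈ Q, v ∉ P ∧ p • v ∈ P := by
  obtain ⟨v, hvQ, hvP⟩ := SetLike.exists_of_lt h
  have hex : ∃ m : ℕ, p ^ m • v ∈ P := by
    refine ⟨r, ?_⟩
    rw [← Nat.cast_smul_eq_nsmul (ZMod (p ^ r)), ZMod.natCast_self, zero_smul]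
    exact P.zero_mem
  classical
  have hs := Nat.find_spec hex
  obtain ⟨m, hm⟩ : ∃ m, Nat.find hex = m + 1 :=
    Nat.exists_eq_succ_of_ne_zero fun h0 => hvP (by simpa [h0] using hs)
  rw [hm] at hs
  refine ⟨p ^ m • v, Q.smul_of_tower_mem _ hvQ, Nat.find_min hex (by omega), ?_⟩
  rwa [smul_smul, ← pow_succ']

lemma PartialBasis.exists_leadModule (hp : p.Prime) (hP : P ≤ leadModule M d)
    (h : PartialBasis M d P G) :
    ∃ (l : ℕ) (H : Fin l → Fin n → (ZMod (p ^ r))[X]), PartialBasis M d (leadModule M d) H := by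
  have : NeZero (p ^ r) := ⟨pow_ne_zero _ hp.ne_zero⟩
  induction P using WellFoundedGT.induction generalizing k with
  | ind P ih =>
    rcases hP.eq_or_lt with rfl | hlt
    · exact ⟨k, G, h⟩
    · obtain ⟨_, ⟨w, hw, hwd, rfl⟩, hvP, hpv⟩ := exists_notMem_nsmul_mem hlt
      refine ih _ ?_ ?_ (h.cons hp hw hwd hvP hpv)
      · rw [left_lt_sup]
        exact fun hle => hvP (hle (Submodule.mem_span_singleton_self _))
      · refine sup_le hP ?_
        rw [Submodule.span_singleton_le_iff_mem]
        exact ⟨w, hw, hwd, rfl⟩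

lemma exists_partialBasis (hp : p.Prime)
    (M : Submodule (ZMod (p ^ r))[X] (Fin n → (ZMod (p ^ r))[X])) (d : ℕ) :
    ∃ (k : ℕ) (G : Fin k → Fin n → (ZMod (p ^ r))[X]), PartialBasis M d (leadModule M d) G := by
  induction d with
  | zero => exact partialBasis_zero.exists_leadModule hp bot_le
  | succ d ih =>
    obtain ⟨k, G, h⟩ := ih
    exact (h.succ).exists_leadModule hp (leadModule_mono M d.le_succ)

/-- Every submodule of `(ℤ / p ^ r)[D] ^ n` is generated, with digit coefficients, by a reduced
generator sequence. -/
theorem exists_reduced_generatorSequence (hp : p.Prime)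
    (M : Submodule (ZMod (p ^ r))[X] (Fin n → (ZMod (p ^ r))[X])) :
    ∃ (k : ℕ) (G : Matrix (Fin k) (Fin n) (ZMod (p ^ r))[X]),
      (∀ j, G j ∈ M) ∧ GeneratorSequence p (digitPoly p r) G ∧
      DigitIndependent (digits p r) (leadingRowCoeff G) ∧
      ∀ w ∈ M, ∃ a : Fin k → (ZMod (p ^ r))[X], (∀ j, a j ∈ digitPoly p r) ∧
        w = ∑ j, a j • G j := by
  have : NeZero (p ^ r) := ⟨pow_ne_zero _ hp.ne_zero⟩
  obtain ⟨d, hd⟩ := monotone_stabilizes_iff_noetherian.2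
    (inferInstance : IsNoetherian (ZMod (p ^ r)) (Fin n → ZMod (p ^ r)))
    ⟨leadModule M, leadModule_mono M⟩
  obtain ⟨k, G, h⟩ := exists_partialBasis hp M d
  have hall : ∀ e, PartialBasis M (d + e) (leadModule M (d + e)) G := by
    intro e
    induction e with
    | zero => exact h
    | succ e ih =>
      have heq : leadModule M (d + e) = leadModule M (d + (e + 1)) :=
        (hd (d + e) (by omega)).symm.trans (hd (d + (e + 1)) (by omega))
      exact heq ▸ ih.succ
  refine ⟨k, G, h.mem, h.generator, h.reduced, fun w hw => ?_⟩
  have hwd : DegreeLE (d + rowDegree w) w := fun e he => degreeLE_rowDegree w e (by omega)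
  obtain ⟨a, ha, -, he⟩ := (hall (rowDegree w)).exists_digits w hw hwd ⟨w, hw, hwd, rfl⟩
  exact ⟨a, ha, he⟩

end Reduced

/-! ### Polynomial words of a code -/

section Laurent

variable {R : Type*} [CommRing R] {n : ℕ}

/-- A polynomial vector, viewed as a vector of Laurent series. -/
def laurentVec (w : Fin n → R[X]) : Fin n → LaurentSeries R := fun i => polyToLaurent R (w i)

lemma laurentVec_smul (a : R[X]) (w : Fin n → R[X]) :
    laurentVec (a • w) = polyToLaurent R a • laurentVec w :=
  funext fun i => map_mul (polyToLaurent R) a (w i)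

lemma laurentVec_sum {k : ℕ} (w : Fin k → Fin n → R[X]) :
    laurentVec (∑ j, w j) = ∑ j, laurentVec (w j) := by
  ext1 i
  simp only [laurentVec, Finset.sum_apply, map_sum]

lemma encode_eq_sum {k : ℕ} (G : Matrix (Fin k) (Fin n) R[X]) (u : Fin k → LaurentSeries R) :
    encode G u = ∑ j, u j • laurentVec (G j) := by
  ext1 i
  simp only [encode, Matrix.vecMul, dotProduct, Matrix.map_apply, Finset.sum_apply, Pi.smul_apply,
    smul_eq_mul, laurentVec]

lemma encode_smul {k : ℕ} (G : Matrix (Fin k) (Fin n) R[X]) (c : LaurentSeries R)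
    (u : Fin k → LaurentSeries R) : encode G (c • u) = c • encode G u :=
  Matrix.smul_vecMul _ _ _

lemma encode_laurentVec {k : ℕ} (G : Matrix (Fin k) (Fin n) R[X]) (a : Fin k → R[X]) :
    encode G (laurentVec a) = laurentVec (∑ j, a j • G j) := by
  rw [encode_eq_sum, laurentVec_sum]
  exact Finset.sum_congr rfl fun j _ => (laurentVec_smul _ _).symm

lemma coeff_polyToLaurent (f : R[X]) (e : ℤ) :
    (polyToLaurent R f).coeff e = if e < 0 then 0 else f.coeff e.natAbs := by
  have := PowerSeries.coeff_coe (f : PowerSeries R) e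
  rw [Polynomial.coeff_coe] at this
  exact this

lemma polyToLaurent_X : polyToLaurent R Polynomial.X = HahnSeries.single 1 1 := by
  change HahnSeries.ofPowerSeries ℤ R ((Polynomial.X : R[X]) : PowerSeries R) = _
  rw [Polynomial.coe_X, HahnSeries.ofPowerSeries_X]

lemma single_smul_single_smul {V : Type*} [AddCommGroup V] [Module (LaurentSeries R) V] {a b : ℤ}
    (h : a + b = 0) (v : V) :
    (HahnSeries.single a (1 : R) : LaurentSeries R) • (HahnSeries.single b (1 : R) :
      LaurentSeries R) • v = v := by
  rw [smul_smul, HahnSeries.single_mul_single, h, one_mul, HahnSeries.single_zero_one, one_smul]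

lemma coeff_single_one_mul (N e : ℤ) (f : LaurentSeries R) :
    ((HahnSeries.single N (1 : R) : LaurentSeries R) * f).coeff e = f.coeff (e - N) := by
  rw [HahnSeries.coeff_single_mul, one_mul]

/-- A vector of Laurent series has finite weight exactly when some power of `D` shifts it to a
polynomial vector. -/
lemma weight_lt_top_iff (u : Fin n → LaurentSeries R) :
    weight u < ⊤ ↔ ∃ (N : ℤ) (q : Fin n → R[X]),
      (HahnSeries.single N (1 : R) : LaurentSeries R) • u = laurentVec q := by
  have hfin : weight u < ⊤ ↔ ∀ i, {e : ℤ | (u i).coeff e ≠ 0}.Finite := by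
    rw [weight, ENat.sum_lt_top]
    simp only [Finset.mem_univ, true_imp_iff, Set.encard_lt_top_iff]
  rw [hfin]
  constructor
  · intro h
    have hU := Set.finite_iUnion h
    obtain ⟨B, hB⟩ := hU.bddBelow
    obtain ⟨T, hT⟩ := hU.bddAbove
    have hlow : ∀ i e, e < B → (u i).coeff e = 0 := fun i e he => by
      by_contra hne
      exact absurd (hB (Set.mem_iUnion.2 ⟨i, hne⟩)) (not_le.2 he)
    have hup : ∀ i e, T < e → (u i).coeff e = 0 := fun i e he => by
      by_contra hne
      exact absurd (hT (Set.mem_iUnion.2 ⟨i, hne⟩)) (not_le.2 he)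
    refine ⟨-B, fun i => ∑ m ∈ Finset.range (T - B + 1).toNat,
      Polynomial.monomial m ((u i).coeff (m + B)), ?_⟩
    ext i e
    rw [Pi.smul_apply, smul_eq_mul, coeff_single_one_mul, laurentVec, coeff_polyToLaurent,
      sub_neg_eq_add]
    split_ifs with he
    · exact hlow i _ (by omega)
    · rw [Polynomial.finsetSum_coeff]
      simp only [Polynomial.coeff_monomial, Finset.sum_ite_eq', Finset.mem_range]
      split_ifs with hlt
      · congr 2
        omega
      · exact hup i _ (by omega)
  · rintro ⟨N, q, hq⟩ i
    refine ((q i).support.finite_toSet.image fun m : ℕ => (m : ℤ) - N).subset fun e he => ?_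
    have hc := congrArg (fun f => (f i).coeff (e + N)) hq
    simp only [Pi.smul_apply, smul_eq_mul, coeff_single_one_mul, laurentVec, coeff_polyToLaurent,
      add_sub_cancel_right] at hc
    rw [Set.mem_ofPred_eq, hc] at he
    split_ifs at he with hneg
    · exact absurd rfl he
    · refine ⟨(e + N).natAbs, Polynomial.mem_support_iff.2 he, ?_⟩
      simp only
      omega

/-- The polynomial vectors that belong to `C`. -/
def polyWords (C : Submodule (LaurentSeries R) (Fin n → LaurentSeries R)) :
    Submodule R[X] (Fin n → R[X]) where
  carrier := {w | laurentVec w ∈ C}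
  zero_mem' := by
    have : laurentVec (0 : Fin n → R[X]) = 0 := funext fun i => map_zero (polyToLaurent R)
    rw [Set.mem_ofPred_eq, this]
    exact C.zero_mem
  add_mem' {v w} hv hw := by
    have : laurentVec (v + w) = laurentVec v + laurentVec w :=
      funext fun i => map_add (polyToLaurent R) _ _
    rw [Set.mem_ofPred_eq, this]
    exact C.add_mem hv hw
  smul_mem' a w hw := by
    rw [Set.mem_ofPred_eq, laurentVec_smul]
    exact C.smul_mem _ hw

lemma mem_polyWords {C : Submodule (LaurentSeries R) (Fin n → LaurentSeries R)}
    {w : Fin n → R[X]} : w ∈ polyWords C ↔ laurentVec w ∈ C := Iff.rfl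

lemma laurentVec_X_smul (w : Fin n → R[X]) :
    laurentVec ((Polynomial.X : R[X]) • w) =
      (HahnSeries.single 1 (1 : R) : LaurentSeries R) • laurentVec w := by
  rw [laurentVec_smul, polyToLaurent_X]

/-- The polynomial words are saturated with respect to `D`, which is a unit in Laurent series. -/
lemma mem_polyWords_of_X_smul {C : Submodule (LaurentSeries R) (Fin n → LaurentSeries R)}
    {w : Fin n → R[X]} (h : (Polynomial.X : R[X]) • w ∈ polyWords C) : w ∈ polyWords C := by
  rw [mem_polyWords, laurentVec_X_smul] at h
  rw [mem_polyWords,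
    ← single_smul_single_smul (R := R) (by norm_num : (-1 : ℤ) + 1 = 0) (laurentVec w)]
  exact C.smul_mem _ h

/-- The lowest coefficient of a product of a Laurent series and a polynomial, at an order bound
which need not be attained. -/
lemma coeff_mul_polyToLaurent {f : LaurentSeries R} {N : ℤ} (hf : ∀ e < N, f.coeff e = 0)
    (g : R[X]) : (f * polyToLaurent R g).coeff N = f.coeff N * g.coeff 0 := by
  let F : PowerSeries R := PowerSeries.mk fun m => f.coeff (N + m)
  have hF : f =
      (HahnSeries.single N (1 : R) : LaurentSeries R) * HahnSeries.ofPowerSeries ℤ R F := by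
    ext e
    have := PowerSeries.coeff_coe F (e - N)
    rw [coeff_single_one_mul, this]
    split_ifs with he
    · exact hf e (by omega)
    · rw [PowerSeries.coeff_mk]
      congr 1
      omega
  have hg : polyToLaurent R g = HahnSeries.ofPowerSeries ℤ R (g : PowerSeries R) := rfl
  have hc := PowerSeries.coeff_coe (F * (g : PowerSeries R)) 0
  conv_lhs => rw [hF]
  rw [mul_assoc, hg, ← map_mul, coeff_single_one_mul, sub_self, hc]
  simp [F]

end Laurent

section Code

variable {p r n k : ℕ} {G : Matrix (Fin k) (Fin n) (ZMod (p ^ r))[X]}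
  {C : Submodule (LaurentSeries (ZMod (p ^ r))) (Fin n → LaurentSeries (ZMod (p ^ r)))}

lemma generatorSequence_laurentVec (h : GeneratorSequence p (digitPoly p r) G) :
    GeneratorSequence p Set.univ fun j => laurentVec (G j) := by
  intro i
  obtain ⟨a, -, he⟩ := h i
  refine ⟨laurentVec a, fun _ => trivial, ?_⟩
  have hp : laurentVec (p • G i) = p • laurentVec (G i) :=
    funext fun l => map_nsmul (polyToLaurent _) p (G i l)
  rw [← hp, he]
  ext1 l
  simp only [laurentVec, Finset.sum_apply, map_sum, Pi.smul_apply, smul_eq_mul, map_mul]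

/-- Independence of the rows of `G(0)` passes to Laurent series coefficients: in a nontrivial
combination the terms of least order cannot cancel. -/
lemma digitIndependent_of_isDelayFree (h : IsDelayFree p r G) :
    DigitIndependent (digitLaurent p r) fun j => laurentVec (G j) := by
  intro u hu hs
  by_contra hne
  push Not at hne
  obtain ⟨j₀, hj₀⟩ := hne
  classical
  let s : Finset (Fin k) := Finset.univ.filter fun j => u j ≠ 0
  obtain ⟨m, hm, hmin⟩ := s.exists_min_image (fun j => (u j).order) ⟨j₀, by simpa [s] using hj₀⟩
  have hlow : ∀ j, ∀ e < (u m).order, (u j).coeff e = 0 := fun j e he => by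
    by_cases h0 : u j = 0
    · simp [h0]
    · exact HahnSeries.coeff_eq_zero_of_lt_order (he.trans_le (hmin j (by simpa [s] using h0)))
  have hsum : ∑ j, (u j).coeff (u m).order • valueAtZero G j = 0 := by
    ext i
    have hi := congrArg (fun f => (f i).coeff (u m).order) hs
    simp only [Finset.sum_apply, Pi.smul_apply, smul_eq_mul, HahnSeries.coeff_sum, laurentVec,
      Pi.zero_apply, HahnSeries.coeff_zero, coeff_mul_polyToLaurent (hlow _)] at hi
    simp only [Finset.sum_apply, Pi.smul_apply, smul_eq_mul, valueAtZero, Pi.zero_apply,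
      ← Polynomial.coeff_zero_eq_eval_zero]
    exact hi
  have h0 := h (fun j => (u j).coeff (u m).order) (fun j => hu j _) hsum m
  exact (Finset.mem_filter.1 hm).2 (HahnSeries.coeff_order_eq_zero.1 h0)

/-- A generating sequence of all polynomial words is delay-free. A vanishing combination of the
rows of `G(0)` comes from a polynomial word that is divisible by `D`. Its quotient by `D` is again
a polynomial word, which yields a second representation, with coefficients divisible by `D`. -/
lemma isDelayFree_of_generates (hp : p.Prime) (hr : 1 ≤ r) (hG : ∀ j, G j ∈ polyWords C)
    (hgen : GeneratorSequence p (digitPoly p r) G) (hi : DigitIndependent (digitPoly p r) G)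
    (hspan : ∀ w ∈ polyWords C, ∃ a : Fin k → (ZMod (p ^ r))[X],
      (∀ j, a j ∈ digitPoly p r) ∧ w = ∑ j, a j • G j) : IsDelayFree p r G := by
  intro a ha hs
  let w : Fin n → (ZMod (p ^ r))[X] := ∑ j, (Polynomial.C (a j) : (ZMod (p ^ r))[X]) • G j
  have hw0 : ∀ i, (w i).coeff 0 = 0 := fun i => by
    have := congrFun hs i
    simp only [Finset.sum_apply, Pi.smul_apply, smul_eq_mul, valueAtZero, Pi.zero_apply,
      ← Polynomial.coeff_zero_eq_eval_zero] at this
    simp only [w, Finset.sum_apply, Pi.smul_apply, smul_eq_mul, Polynomial.finsetSum_coeff,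
      Polynomial.coeff_C_mul]
    exact this
  have hX : (Polynomial.X : (ZMod (p ^ r))[X]) • (fun i => (w i).divX) = w := by
    ext1 i
    have := (w i).X_mul_divX_add
    rwa [hw0, map_zero, add_zero] at this
  have hw : w ∈ polyWords C := Submodule.sum_mem _ fun j _ => Submodule.smul_mem _ _ (hG j)
  obtain ⟨b, hb, hbe⟩ := hspan _ (mem_polyWords_of_X_smul (hX.symm ▸ hw))
  have hCa : ∀ j, Polynomial.C (a j) ∈ digitPoly p r := fun j i => by
    rw [Polynomial.coeff_C]
    split_ifs
    · exact ha j
    · exact zero_mem_digits hp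
  have hXb : ∀ j, Polynomial.X * b j ∈ digitPoly p r := fun j i => by
    cases i with
    | zero => simpa using zero_mem_digits hp
    | succ i =>
      rw [Polynomial.coeff_X_mul]
      exact hb j i
  have hu := (hgen.mono (Set.subset_univ _)).digits_unique (isDigitSystem_digitPoly hp hr) hi hCa
    hXb (by
      simp only [mul_smul]
      rw [← Finset.smul_sum, ← hbe, hX])
  intro j
  have := congrArg (Polynomial.coeff · 0) (congrFun hu j)
  simpa using this

/-- If the output has finite weight, then so has the input: a shift of the output is a polynomial
word, which is also the output of a polynomial input, and inputs are unique. -/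
lemma isNoncatastrophic_of_generates (hp : p.Prime) (hr : 1 ≤ r) (hG : ∀ j, G j ∈ polyWords C)
    (hgen : GeneratorSequence p (digitPoly p r) G) (hd : IsDelayFree p r G)
    (hspan : ∀ w ∈ polyWords C, ∃ a : Fin k → (ZMod (p ^ r))[X],
      (∀ j, a j ∈ digitPoly p r) ∧ w = ∑ j, a j • G j) : IsNoncatastrophic p r G := by
  intro u hu
  rw [weight_lt_top_iff, weight_lt_top_iff]
  constructor
  · rintro ⟨N, w, hw⟩
    have hwC : w ∈ polyWords C := by
      rw [mem_polyWords, ← hw, encode_eq_sum]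
      exact C.smul_mem _ (C.sum_mem fun j _ => C.smul_mem _ (hG j))
    obtain ⟨a, ha, rfl⟩ := hspan w hwC
    refine ⟨N, a, ?_⟩
    refine (generatorSequence_laurentVec hgen).digits_unique (isDigitSystem_digitLaurent hp hr)
      (digitIndependent_of_isDelayFree hd) (fun j e => ?_) (fun j e => ?_) ?_
    · rw [Pi.smul_apply, smul_eq_mul, coeff_single_one_mul]
      exact hu j _
    · rw [laurentVec, coeff_polyToLaurent]
      split_ifs
      · exact zero_mem_digits hp
      · exact ha j _
    · rw [← encode_eq_sum, ← encode_eq_sum, encode_smul, hw, encode_laurentVec]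
  · rintro ⟨N, a, ha⟩
    exact ⟨N, ∑ j, a j • G j, by rw [← encode_smul, ha, encode_laurentVec]⟩

/-- The code is the set of outputs of digit inputs: the rows of a polynomial generator matrix are
polynomial words, so the rows of `G` generate the code over Laurent series, and coefficients can be
reduced to digits. -/
lemma mem_iff_exists_digitLaurent (hp : p.Prime) (hr : 1 ≤ r) (hC : IsConvolutionalCode C)
    (hG : ∀ j, G j ∈ polyWords C) (hgen : GeneratorSequence p (digitPoly p r) G)
    (hspan : ∀ w ∈ polyWords C, ∃ a : Fin k → (ZMod (p ^ r))[X],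
      (∀ j, a j ∈ digitPoly p r) ∧ w = ∑ j, a j • G j) (v : Fin n → LaurentSeries (ZMod (p ^ r))) :
    v ∈ C ↔ ∃ u, (∀ j, u j ∈ digitLaurent p r) ∧ v = encode G u := by
  constructor
  · intro hv
    obtain ⟨m, H, hH⟩ := hC
    have hrow : ∀ i, H i ∈ polyWords C := fun i => by
      rw [mem_polyWords, hH]
      refine ⟨Pi.single i 1, ?_⟩
      rw [encode_eq_sum, Finset.sum_eq_single i]
      · rw [Pi.single_eq_same, one_smul]
      · intro j _ hj
        rw [Pi.single_eq_of_ne hj, zero_smul]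
      · exact fun h => absurd (Finset.mem_univ i) h
    choose a _ hae using fun i => hspan (H i) (hrow i)
    obtain ⟨x, rfl⟩ := (hH v).1 hv
    obtain ⟨u, hu, he⟩ := (generatorSequence_laurentVec hgen).exists_digits
      (isDigitSystem_digitLaurent hp hr) fun j => ∑ i, x i * polyToLaurent _ (a i j)
    refine ⟨u, hu, ?_⟩
    rw [encode_eq_sum, encode_eq_sum, ← he]
    simp only [Finset.sum_smul, mul_smul]
    rw [Finset.sum_comm]
    refine Finset.sum_congr rfl fun i _ => ?_
    rw [hae i, laurentVec_sum, Finset.smul_sum]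
    simp only [laurentVec_smul]
  · rintro ⟨u, -, rfl⟩
    rw [encode_eq_sum]
    exact C.sum_mem fun j _ => C.smul_mem _ (hG j)

end Code

end PConv

end

theorem mainTheorem1 (p r n : ℕ) (hp : p.Prime) (hr : 1 ≤ r)
    (C : Submodule (LaurentSeries (ZMod (p ^ r))) (Fin n → LaurentSeries (ZMod (p ^ r))))
    (hC : PConv.IsConvolutionalCode C) :
    ∃ (k : ℕ) (G : Matrix (Fin k) (Fin n) (Polynomial (ZMod (p ^ r)))),
      PConv.IsMinimalPEncoder p r G C := by
  obtain ⟨k, G, hG, hgen, hred, hspan⟩ :=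
    PConv.exists_reduced_generatorSequence hp (PConv.polyWords C)
  have hi := PConv.digitIndependent_of_reduced hp hred
  have hd := PConv.isDelayFree_of_generates hp hr hG hgen hi hspan
  exact ⟨k, G, ⟨hgen, hi, PConv.mem_iff_exists_digitLaurent hp hr hC hG hgen hspan⟩, hd,
    PConv.isNoncatastrophic_of_generates hp hr hG hgen hd hspan, hred⟩
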